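/- Let $\alpha\in[0,\infty]$ and $t>0$. For a finite non-empty metric space $(F,d)$ and a probability vector $p=(p_x)_{x\in F}$, put $(Zp)_x=\sum_{y\in F}e^{-t\,d(x,y)}p_y$ and $$H_\alpha(p)=\begin{cases}\frac{1}{1-\alpha}\log\Big(\sum_{x}p_x\,(Zp)_x^{\alpha-1}\Big), & \alpha\in[0,1)\cup(1,\infty),\\[2pt] -\sum_x p_x\log (Zp)_x, & \alpha=1,\\[2pt] -\log\Big(\max_{x:\,p_x>0}(Zp)_x\Big), & \alpha=\infty.\end{cases}$$ Let $C^t(F)=\sup_p H_\alpha(p)$, the supremum being over all probability vectors $p$ on $F$, and let $C^t(\emptyset)=0$. (By a theorem of Leinster and Meckes, $C^t(F)$ does not depend on $\alpha$; the result below is asserted for $C^t$ defined with any choice of $\alpha\in[0,\infty]$.) For a compact subset $K$ of a metric space let $C^t(K)=\sup\{C^t(F):F\subseteq K,\ F\text{ finite}\}$, which is finite, and let $\kappa^t(K)=e^{C^t(K)}-1$. Let $A,B\subseteq\mathbb{R}$ be non-empty and compact, where $\mathbb{R}$ carries its usual metric. Then for all $t>0$ $$\kappa^t(A+B)\ \ge\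 \kappa^t(A)+\kappa^t(B),$$ where $A+B=\{a+b:a\in A,\ b\in B\}$. Further, for all $t>0$ and $\lambda\in[0,1]$, $$\kappa^t\big((1-\lambda)A+\lambda B\big)\ \ge\ (1-\lambda)\,\kappa^t(A)+\lambda\,\kappa^t(B).$$ -/

import Mathlib

open scoped ENNReal Pointwise

noncomputable section

namespace MetricComplexity

/-- The kernelized `α`-complexity `H_α^Z(p)` of a probability vector `p` on a finite set `X`, for
`α ∈ [0, ∞]`; here `(Zp)_x = ∑ y, Z x y * p y` is `(Z *ᵥ p) x`. -/
def alphaComplexity {X : Type*} [Fintype X] (Z : Matrix X X ℝ) (α : ℝ≥0∞) (p : X → ℝ) : ℝ :=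
  if α = 1 then
    -∑ x, p x * Real.log ((Z.mulVec p) x)
  else if α = ∞ then
    -Real.log (sSup ((Z.mulVec p) '' Function.support p))
  else
    1 / (1 - α.toReal) * Real.log (∑ x, p x * ((Z.mulVec p) x) ^ (α.toReal - 1))

/-- The kernelized complexity of a finite set with respect to `Z`, computed with order `α`:
the supremum of `H_α^Z(p)` over all probability vectors `p`. It is `0` for the empty set. -/
def kernelComplexity (X : Type*) [Fintype X] (Z : Matrix X X ℝ) (α : ℝ≥0∞) : ℝ :=
  sSup (alphaComplexity Z α '' stdSimplex ℝ X)

/-- The Laplace kernel `e^{-t d(x,y)}` of the rescaled metric space `(X, t d)`. -/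
def laplaceKernel (X : Type*) [MetricSpace X] (t : ℝ) : Matrix X X ℝ :=
  Matrix.of fun x y => Real.exp (-(t * dist x y))

/-- `C^t(A)` for a finite subset `A` of a metric space. -/
def finComplexity {X : Type*} [MetricSpace X] (α : ℝ≥0∞) (t : ℝ) (A : Finset X) : ℝ :=
  kernelComplexity A (laplaceKernel A t) α

/-- `C^t(K)` for a compact subset `K` of a metric space: the supremum of `C^t(A)` over the finite
subsets `A` of `K`. -/
def complexity {X : Type*} [MetricSpace X] (α : ℝ≥0∞) (t : ℝ) (K : Set X) : ℝ :=
  sSup (finComplexity α t '' {A : Finset X | (A : Set X) ⊆ K})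

/-- `κ^t(K) = exp (C^t(K)) - 1`. -/
def kappa {X : Type*} [MetricSpace X] (α : ℝ≥0∞) (t : ℝ) (K : Set X) : ℝ :=
  Real.exp (complexity α t K) - 1

/-- If all entries of `Z` are at least `e^{-c}`, then every `H_α^Z(p)` is at most `c`. -/
theorem alphaComplexity_le {X : Type*} [Fintype X] (Z : Matrix X X ℝ) (α : ℝ≥0∞) {c : ℝ}
    (hZ : ∀ x y, Real.exp (-c) ≤ Z x y) {p : X → ℝ} (hp : p ∈ stdSimplex ℝ X) :
    alphaComplexity Z α p ≤ c := by
  obtain ⟨hp0, hp1⟩ := hp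
  have hlow : ∀ x, Real.exp (-c) ≤ (Z.mulVec p) x := by
    intro x
    calc Real.exp (-c) = ∑ y, Real.exp (-c) * p y := by rw [← Finset.mul_sum, hp1, mul_one]
      _ ≤ (Z.mulVec p) x := Finset.sum_le_sum fun y _ => mul_le_mul_of_nonneg_right (hZ x y) (hp0 y)
  have hpos : ∀ x, 0 < (Z.mulVec p) x := fun x => (Real.exp_pos _).trans_le (hlow x)
  have hlog : ∀ x, -c ≤ Real.log ((Z.mulVec p) x) := fun x =>
    (Real.le_log_iff_exp_le (hpos x)).2 (hlow x)
  unfold alphaComplexity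
  split_ifs with h1 h2
  · have : ∑ x, p x * (-c) ≤ ∑ x, p x * Real.log ((Z.mulVec p) x) :=
      Finset.sum_le_sum fun x _ => mul_le_mul_of_nonneg_left (hlog x) (hp0 x)
    rw [← Finset.sum_mul, hp1] at this
    linarith
  · obtain ⟨x, hx⟩ : ∃ x, p x ≠ 0 := by
      by_contra! h
      simp [h] at hp1
    have hle : (Z.mulVec p) x ≤ sSup ((Z.mulVec p) '' Function.support p) :=
      le_csSup (Set.toFinite _).bddAbove ⟨x, hx, rfl⟩
    have := Real.log_le_log (hpos x) hle
    linarith [hlog x]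
  · have hα : α.toReal ≠ 1 := by
      intro h
      apply h1
      rw [← ENNReal.ofReal_toReal h2, h, ENNReal.ofReal_one]
    have hexp : ∀ x, ((Z.mulVec p) x) ^ (α.toReal - 1)
        = Real.exp (Real.log ((Z.mulVec p) x) * (α.toReal - 1)) := fun x =>
      Real.rpow_def_of_pos (hpos x) _
    have hsum : ∑ x, p x * Real.exp (-c * (α.toReal - 1)) = Real.exp (-c * (α.toReal - 1)) := by
      rw [← Finset.sum_mul, hp1, one_mul]
    rcases lt_or_gt_of_ne hα with h | h
    · have hS : ∑ x, p x * ((Z.mulVec p) x) ^ (α.toReal - 1)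
          ≤ Real.exp (-c * (α.toReal - 1)) := by
        rw [← hsum]
        refine Finset.sum_le_sum fun x _ => mul_le_mul_of_nonneg_left ?_ (hp0 x)
        rw [hexp]
        exact Real.exp_le_exp.2 (mul_le_mul_of_nonpos_right (hlog x) (by linarith))
      have hS0 : 0 < ∑ x, p x * ((Z.mulVec p) x) ^ (α.toReal - 1) := by
        refine lt_of_le_of_ne (Finset.sum_nonneg fun x _ =>
          mul_nonneg (hp0 x) (Real.rpow_nonneg (hpos x).le _)) fun h0 => ?_
        rw [eq_comm, Finset.sum_eq_zero_iff_of_nonneg fun x _ =>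
          mul_nonneg (hp0 x) (Real.rpow_nonneg (hpos x).le _)] at h0
        have hz : ∀ x, p x = 0 := fun x =>
          (mul_eq_zero.1 (h0 x (Finset.mem_univ x))).resolve_right
            (Real.rpow_pos_of_pos (hpos x) _).ne'
        simp [hz] at hp1
      have := (Real.log_le_iff_le_exp hS0).2 hS
      rw [one_div, inv_mul_le_iff₀ (by linarith)]
      linarith
    · have hS : Real.exp (-c * (α.toReal - 1))
          ≤ ∑ x, p x * ((Z.mulVec p) x) ^ (α.toReal - 1) := by
        rw [← hsum]
        refine Finset.sum_le_sum fun x _ => mul_le_mul_of_nonneg_left ?_ (hp0 x)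
        rw [hexp]
        exact Real.exp_le_exp.2 (mul_le_mul_of_nonneg_right (hlog x) (by linarith))
      have := (Real.le_log_iff_exp_le ((Real.exp_pos _).trans_le hS)).2 hS
      have h3 : 1 / (1 - α.toReal) = -(α.toReal - 1)⁻¹ := by
        rw [one_div, ← inv_neg, neg_sub]
      rw [h3, neg_mul, neg_le, le_inv_mul_iff₀ (by linarith)]
      linarith

/-- The supremum over probability vectors in `finComplexity` is over a bounded set. -/
theorem bddAbove_alphaComplexity {X : Type*} [MetricSpace X] (α : ℝ≥0∞) (t : ℝ) (A : Finset X) :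
    BddAbove (alphaComplexity (laplaceKernel A t) α '' stdSimplex ℝ A) := by
  obtain ⟨c, hc⟩ := (Set.finite_range fun q : A × A => t * dist q.1 q.2).bddAbove
  refine ⟨c, ?_⟩
  rintro _ ⟨p, hp, rfl⟩
  exact alphaComplexity_le _ α
    (fun x y => Real.exp_le_exp.2 (neg_le_neg (hc ⟨(x, y), rfl⟩))) hp

/-- The supremum over finite subsets in `complexity` is over a bounded set if `K` is compact. -/
theorem bddAbove_finComplexity {X : Type*} [MetricSpace X] (α : ℝ≥0∞) {t : ℝ} (ht : 0 < t)
    {K : Set X} (hK : IsCompact K) :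
    BddAbove (finComplexity α t '' {A : Finset X | (A : Set X) ⊆ K}) := by
  refine ⟨t * Metric.diam K, ?_⟩
  rintro _ ⟨A, hA, rfl⟩
  refine Real.sSup_le ?_ (mul_nonneg ht.le Metric.diam_nonneg)
  rintro _ ⟨p, hp, rfl⟩
  refine alphaComplexity_le _ α (fun x y => Real.exp_le_exp.2 (neg_le_neg ?_)) hp
  exact mul_le_mul_of_nonneg_left
    (Metric.dist_le_diam_of_mem hK.isBounded (hA x.2) (hA y.2)) ht.le

end MetricComplexity

end

namespace MetricComplexity

/-! For finite non-empty `F ⊆ ℝ` with consecutive gaps `g`, one has `C^t(F) = log (1 + ∑ tanh (t g /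
2))`, so for compact non-empty `K` the number `κ^t(K)` is the supremum of these gap sums over finite
subsets (`isLUB_kappa`). For the formula, a non-negative weighting, normalised, makes `Zp` constant
and attains the value for every `α` (`exists_weighting`). Conversely `H_α ≤ H_0` by Jensen, and
`H_0` is bounded by induction on the largest point (`sum_div_potential_le`).

Given `F ⊆ A` and `G ⊆ B`, the translates `F + min G` and `max F + G` lie in `A + B` and meet in
exactly one point, so the gap sum of their union is the sum of the two: this is superadditivity.
Since `tanh` is concave on `[0, ∞)` and vanishes at `0`, scaling by `l ∈ [0, 1]` multiplies gap sums
by at least `l`; the second inequality follows. -/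

/-- The contribution of two neighbouring points at rescaled distance `x` to the magnitude of a
finite subset of the line; it equals `tanh (x / 2)`. -/
noncomputable def gapWeight (x : ℝ) : ℝ := (1 - Real.exp (-x)) / (1 + Real.exp (-x))

/-- `GapSum t F a b s` says that the finite set `F ⊆ ℝ` has minimum `a` and maximum `b`, and that
`s` is the sum of `gapWeight (t * g)` over the gaps `g` between consecutive points of `F`. -/
inductive GapSum (t : ℝ) : Finset ℝ → ℝ → ℝ → ℝ → Prop
  | single (a : ℝ) : GapSum t {a} a a 0
  | insertMax {F : Finset ℝ} {a b s : ℝ} (m : ℝ) (h : GapSum t F a b s) (hm : b < m) :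
      GapSum t (insert m F) a m (s + gapWeight (t * (m - b)))

/-- The potential `∑ y ∈ F, e^{-t |x - y|} p y` of `p` at `x`. -/
noncomputable def potential (t : ℝ) (F : Finset ℝ) (p : ℝ → ℝ) (x : ℝ) : ℝ :=
  ∑ y ∈ F, Real.exp (-(t * dist x y)) * p y

theorem gapWeight_nonneg {x : ℝ} (hx : 0 ≤ x) : 0 ≤ gapWeight x := by
  have h : Real.exp (-x) ≤ 1 := Real.exp_le_one_iff.2 (by linarith)
  exact div_nonneg (by linarith) (by positivity)

/-- In this form the derivative is `1 / (2 cosh² (x / 2))`, visibly decreasing for `x ≥ 0`. -/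
theorem hasDerivAt_gapWeight (x : ℝ) :
    HasDerivAt gapWeight (2 * (Real.exp (x / 2) + Real.exp (-(x / 2)))⁻¹ ^ 2) x := by
  have he : HasDerivAt (fun y : ℝ => Real.exp (-y)) (-Real.exp (-x)) x := by
    simpa using (hasDerivAt_neg x).exp
  have h := (he.const_sub 1).fun_div (he.const_add 1) (by positivity)
  refine h.congr_deriv ?_
  have h1 : Real.exp (-x) = Real.exp (-(x / 2)) ^ 2 := by
    rw [← Real.exp_nat_mul]; congr 1; push_cast; ring
  have h2 : Real.exp (x / 2) = (Real.exp (-(x / 2)))⁻¹ := by rw [← Real.exp_neg, neg_neg]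
  rw [h1, h2]
  have := Real.exp_pos (-(x / 2))
  field_simp
  ring

theorem concaveOn_gapWeight : ConcaveOn ℝ (Set.Ici 0) gapWeight := by
  refine AntitoneOn.concaveOn_of_deriv (convex_Ici 0)
    (fun x _ => (hasDerivAt_gapWeight x).continuousAt.continuousWithinAt)
    (fun x _ => (hasDerivAt_gapWeight x).differentiableAt.differentiableWithinAt) ?_
  intro x hx y hy hxy
  rw [interior_Ici, Set.mem_Ioi] at hx hy
  rw [(hasDerivAt_gapWeight x).deriv, (hasDerivAt_gapWeight y).deriv]
  have hc : Real.cosh (x / 2) ≤ Real.cosh (y / 2) := by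
    rw [Real.cosh_le_cosh, abs_of_pos (by linarith), abs_of_pos (by linarith)]
    linarith
  rw [Real.cosh_eq, Real.cosh_eq] at hc
  have hxy' : Real.exp (x / 2) + Real.exp (-(x / 2)) ≤ Real.exp (y / 2) + Real.exp (-(y / 2)) := by
    linarith
  exact mul_le_mul_of_nonneg_left (pow_le_pow_left₀ (by positivity)
    (inv_anti₀ (by positivity) hxy') 2) zero_le_two

theorem mul_gapWeight_le {l x : ℝ} (h0 : 0 ≤ l) (h1 : l ≤ 1) (hx : 0 ≤ x) :
    l * gapWeight x ≤ gapWeight (l * x) := by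
  have h := concaveOn_gapWeight.2 (x := 0) (y := x) (by simp) hx (sub_nonneg.2 h1) h0 (by ring)
  simpa [gapWeight] using h

/-! ### Gap sums under translation, concatenation and scaling -/

namespace GapSum

variable {t : ℝ} {F G : Finset ℝ} {a b c s r : ℝ}

theorem min_mem (h : GapSum t F a b s) : a ∈ F := by
  induction h with
  | single a => simp
  | insertMax m h hm ih => exact Finset.mem_insert_of_mem ih

theorem max_mem (h : GapSum t F a b s) : b ∈ F := by
  cases h <;> simp

theorem le_max (h : GapSum t F a b s) : ∀ x ∈ F, x ≤ b := by
  induction h with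
  | single a => simp
  | insertMax m h hm ih =>
    intro x hx
    rcases Finset.mem_insert.1 hx with rfl | hx
    · exact le_rfl
    · exact (ih x hx).trans hm.le

theorem notMem (h : GapSum t F a b s) {m : ℝ} (hm : b < m) : m ∉ F :=
  fun hF => (h.le_max m hF).not_gt hm

theorem sum_nonneg (ht : 0 ≤ t) (h : GapSum t F a b s) : 0 ≤ s := by
  induction h with
  | single a => exact le_rfl
  | insertMax m h hm ih =>
    exact add_nonneg ih (gapWeight_nonneg (mul_nonneg ht (by linarith)))

theorem exists_of_nonempty (t : ℝ) (F : Finset ℝ) (hF : F.Nonempty) :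
    ∃ a b s, GapSum t F a b s := by
  induction F using Finset.induction_on_max with
  | empty => simp at hF
  | insert m F hm ih =>
    rcases F.eq_empty_or_nonempty with rfl | hne
    · exact ⟨m, m, 0, single m⟩
    · obtain ⟨a, b, s, h⟩ := ih hne
      exact ⟨a, m, _, h.insertMax m (hm b h.max_mem)⟩

theorem translate (h : GapSum t F a b s) (c : ℝ) :
    GapSum t (F.image (· + c)) (a + c) (b + c) s := by
  induction h with
  | single a => simpa using single (a + c)
  | @insertMax F a b s m h hm ih =>
    have h' := ih.insertMax (m + c) (by linarith)
    rw [add_sub_add_right_eq_sub] at h'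
    rwa [Finset.image_insert]

theorem union (hF : GapSum t F a b s) (hG : GapSum t G b c r) :
    GapSum t (F ∪ G) a c (s + r) := by
  induction hG with
  | single b =>
    rw [add_zero, Finset.union_eq_left.2 (Finset.singleton_subset_iff.2 hF.max_mem)]
    exact hF
  | insertMax m h hm ih =>
    rw [Finset.union_insert, ← add_assoc]
    exact (ih hF).insertMax m hm

theorem exists_scale {l : ℝ} (ht : 0 ≤ t) (h0 : 0 ≤ l) (h1 : l ≤ 1) (h : GapSum t F a b s) :
    ∃ s', l * s ≤ s' ∧ GapSum t (F.image (l * ·)) (l * a) (l * b) s' := by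
  induction h with
  | single a => exact ⟨0, by simp, by simpa using single (l * a)⟩
  | @insertMax F a b s m h hm ih =>
    obtain ⟨s', hs, h'⟩ := ih
    rw [Finset.image_insert]
    -- For `l = 0` all points collapse to `0`, so the new point adds no gap.
    rcases h0.eq_or_lt with rfl | hl
    · refine ⟨s', by simpa using hs, ?_⟩
      rw [Finset.insert_eq_of_mem (Finset.mem_image.2 ⟨b, h.max_mem, by simp⟩)]
      simpa using h'
    · refine ⟨_, ?_, h'.insertMax (l * m) (mul_lt_mul_of_pos_left hm hl)⟩
      have := mul_gapWeight_le h0 h1 (mul_nonneg ht (sub_nonneg.2 hm.le))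
      rw [show t * (l * m - l * b) = l * (t * (m - b)) by ring]
      linarith

end GapSum

/-! ### Potentials on the line and magnitude -/

theorem potential_insert {t m : ℝ} {F : Finset ℝ} (hm : m ∉ F) (p : ℝ → ℝ) (x : ℝ) :
    potential t (insert m F) p x = Real.exp (-(t * dist x m)) * p m + potential t F p x :=
  Finset.sum_insert hm

theorem potential_add_single {t b e : ℝ} {F : Finset ℝ} (hb : b ∈ F) (p : ℝ → ℝ) (x : ℝ) :
    potential t F (p + Pi.single b e) x
      = potential t F p x + Real.exp (-(t * dist x b)) * e := by
  simp only [potential, Pi.add_apply, mul_add, Finset.sum_add_distrib]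
  congr 1
  rw [Finset.sum_eq_single_of_mem b hb fun y _ hy => by simp [hy]]
  simp

theorem potential_congr {t : ℝ} {F : Finset ℝ} {p q : ℝ → ℝ} (h : ∀ y ∈ F, p y = q y) (x : ℝ) :
    potential t F p x = potential t F q x :=
  Finset.sum_congr rfl fun y hy => by rw [h y hy]

/-- Distances add along the line, so seen from the left of `b`, mass at `m` acts like mass at `b`
damped by `e^{-t(m-b)}`. Both inductions below rest on this. -/
theorem exp_dist_eq_mul {t x b m : ℝ} (hx : x ≤ b) (hm : b ≤ m) :
    Real.exp (-(t * dist x m)) = Real.exp (-(t * dist x b)) * Real.exp (-(t * (m - b))) := by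
  rw [← Real.exp_add, Real.dist_eq, Real.dist_eq, abs_of_nonpos (by linarith),
    abs_of_nonpos (by linarith)]
  congr 1
  ring

theorem potential_right {t b m : ℝ} {F : Finset ℝ} (hF : ∀ x ∈ F, x ≤ b) (hm : b ≤ m)
    (p : ℝ → ℝ) :
    potential t F p m = Real.exp (-(t * (m - b))) * potential t F p b := by
  rw [potential, potential, Finset.mul_sum]
  refine Finset.sum_congr rfl fun y hy => ?_
  rw [dist_comm m y, dist_comm b y, exp_dist_eq_mul (hF y hy) hm]
  ring

/-- After clearing denominators the difference of the two sides is `(1 - q) q (u - v)²`. -/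
theorem div_sub_div_le {q u v : ℝ} (hq0 : 0 < q) (hq1 : q ≤ 1)
    (h1 : 0 < u + q * v) (h2 : 0 < v + q * u) :
    u / (u + q * v) - q * u / (v + q * u) ≤ (1 - q) / (1 + q) := by
  rw [div_sub_div _ _ h1.ne' h2.ne', div_le_div_iff₀ (by positivity) (by positivity)]
  have : 0 ≤ (1 - q) * (q * (u - v) ^ 2) :=
    mul_nonneg (by linarith) (by positivity)
  nlinarith

namespace GapSum

variable {t : ℝ} {F : Finset ℝ} {a b s : ℝ}

/-- The order `0` diversity of a finite subset of the line is at most its magnitude. -/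
theorem sum_div_potential_le (ht : 0 ≤ t) (h : GapSum t F a b s) {p : ℝ → ℝ}
    (hp : ∀ x ∈ F, 0 ≤ p x) (hpos : ∀ x ∈ F, 0 < potential t F p x) :
    ∑ x ∈ F, p x / potential t F p x ≤ 1 + s := by
  induction h generalizing p with
  | single a =>
    simp [potential, div_self_le_one]
  | @insertMax F a b s m h hm ih =>
    have hmF := h.notMem hm
    set q := Real.exp (-(t * (m - b))) with hq
    have hq1 : q ≤ 1 :=
      Real.exp_le_one_iff.2 (neg_nonpos.2 (mul_nonneg ht (by linarith)))
    have hq0 : 0 < q := Real.exp_pos _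
    have hpm : 0 ≤ p m := hp m (Finset.mem_insert_self _ _)
    -- Replacing the mass at `m` by its damped image at `b` leaves the potential on `F` unchanged.
    -- Total mass is not preserved, hence no normalisation of `p` in the statement.
    set p' : ℝ → ℝ := p + Pi.single b (q * p m) with hp'
    have hU : ∀ x ∈ F, potential t (insert m F) p x = potential t F p' x := by
      intro x hx
      rw [potential_insert hmF, potential_add_single h.max_mem,
        exp_dist_eq_mul (h.le_max x hx) hm.le]
      ring
    have hUm : potential t (insert m F) p m = p m + q * potential t F p b := by
      rw [potential_insert hmF, potential_right h.le_max hm.le]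
      simp [hq]
    have hUb : potential t F p' b = potential t F p b + q * p m := by
      rw [potential_add_single h.max_mem]; simp
    have hp_nonneg : ∀ x ∈ F, 0 ≤ p' x := by
      intro x hx
      refine add_nonneg (hp x (Finset.mem_insert_of_mem hx)) ?_
      rcases eq_or_ne x b with rfl | hxb
      · rw [Pi.single_eq_same]; positivity
      · rw [Pi.single_eq_of_ne hxb]
    have hpos' : ∀ x ∈ F, 0 < potential t F p' x := fun x hx =>
      hU x hx ▸ hpos x (Finset.mem_insert_of_mem hx)
    have hIH := ih hp_nonneg hpos'
    have hsplit : ∑ x ∈ F, p' x / potential t F p' x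
        = ∑ x ∈ F, p x / potential t F p' x + q * p m / potential t F p' b := by
      simp only [hp', Pi.add_apply, add_div, Finset.sum_add_distrib]
      congr 1
      rw [Finset.sum_eq_single_of_mem b h.max_mem fun y _ hy => by simp [hy]]
      simp
    have hkey := div_sub_div_le hq0 hq1
      (hUm ▸ hpos m (Finset.mem_insert_self _ _)) (hUb ▸ hpos' b h.max_mem)
    rw [Finset.sum_insert hmF, Finset.sum_congr rfl fun x hx => by rw [hU x hx], hUm]
    rw [hsplit, hUb] at hIH
    rw [gapWeight, ← hq]
    linarith

/-- A finite subset of the line has a non-negative weighting, of total mass its magnitude. -/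
theorem exists_weighting (ht : 0 ≤ t) (h : GapSum t F a b s) :
    ∃ w : ℝ → ℝ, (∀ x ∈ F, 0 ≤ w x) ∧ 1 / 2 ≤ w b ∧ (∀ x ∈ F, potential t F w x = 1) ∧
      ∑ x ∈ F, w x = 1 + s := by
  induction h with
  | single a => exact ⟨fun _ => 1, by simp, by norm_num, by simp [potential], by simp⟩
  | @insertMax F a b s m h hm ih =>
    obtain ⟨w, hw0, hwb, hw1, hws⟩ := ih
    have hmF := h.notMem hm
    set q := Real.exp (-(t * (m - b))) with hq
    have hq1 : q ≤ 1 :=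
      Real.exp_le_one_iff.2 (neg_nonpos.2 (mul_nonneg ht (by linarith)))
    have hq0 : 0 < q := Real.exp_pos _
    -- The weight `1 / (1 + q)` at `m` is felt on `F` as `q / (1 + q)` at `b`, which is subtracted
    -- there. The invariant `1 / 2 ≤ w b` keeps the result non-negative.
    set w' : ℝ → ℝ := w + Pi.single b (-(q / (1 + q))) with hw'
    set v : ℝ → ℝ := Function.update w' m (1 / (1 + q)) with hv
    have hvm : v m = 1 / (1 + q) := Function.update_self ..
    have hvF : ∀ x ∈ F, v x = w' x := fun x hx =>
      Function.update_of_ne (ne_of_mem_of_not_mem hx hmF) ..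
    have hU : ∀ x, potential t (insert m F) v x
        = Real.exp (-(t * dist x m)) * (1 / (1 + q))
          + (potential t F w x + Real.exp (-(t * dist x b)) * -(q / (1 + q))) := fun x => by
      rw [potential_insert hmF, potential_congr hvF, potential_add_single h.max_mem, hvm]
    refine ⟨v, ?_, ?_, ?_, ?_⟩
    · intro x hx
      rcases Finset.mem_insert.1 hx with rfl | hx
      · rw [hvm]; positivity
      · rw [hvF x hx, hw', Pi.add_apply]
        rcases eq_or_ne x b with rfl | hxb
        · rw [Pi.single_eq_same]
          have : q / (1 + q) ≤ 1 / 2 := by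
            rw [div_le_div_iff₀ (by positivity) (by positivity)]; linarith
          linarith
        · rw [Pi.single_eq_of_ne hxb, add_zero]; exact hw0 x hx
    · rw [hvm]
      exact one_div_le_one_div_of_le (by positivity) (by linarith)
    · intro x hx
      rw [hU]
      rcases Finset.mem_insert.1 hx with rfl | hx
      · rw [potential_right h.le_max hm.le, hw1 b h.max_mem, dist_self, Real.dist_eq,
          abs_of_pos (sub_pos.2 hm), ← hq, mul_zero, neg_zero, Real.exp_zero]
        field_simp
        ring
      · rw [hw1 x hx, exp_dist_eq_mul (h.le_max x hx) hm.le, ← hq]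
        ring
    · rw [Finset.sum_insert hmF, hvm, Finset.sum_congr rfl hvF]
      simp only [hw', Pi.add_apply, Finset.sum_add_distrib, hws]
      rw [Finset.sum_eq_single_of_mem b h.max_mem fun y _ hy => by simp [hy], Pi.single_eq_same,
        gapWeight, ← hq]
      field_simp
      ring

end GapSum

/-! ### Comparison of the orders `α` -/

/-- If `H_0(p) ≤ log M`, then `H_α(p) ≤ log M` for every `α`. -/
theorem alphaComplexity_le_log {X : Type*} [Fintype X] (Z : Matrix X X ℝ) (α : ℝ≥0∞)
    {p : X → ℝ} (hp : p ∈ stdSimplex ℝ X) (hpos : ∀ x, 0 < (Z.mulVec p) x) {M : ℝ}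
    (hM : ∑ x, p x / (Z.mulVec p) x ≤ M) :
    alphaComplexity Z α p ≤ Real.log M := by
  obtain ⟨hp0, hp1⟩ := hp
  set u := Z.mulVec p with hu
  obtain ⟨x₀, hx₀⟩ : ∃ x, p x ≠ 0 := by
    by_contra! h
    simp [h] at hp1
  have hx₀' : 0 < p x₀ := (hp0 x₀).lt_of_ne' hx₀
  have hsum_pos : ∀ f : X → ℝ, (∀ x, 0 < f x) → 0 < ∑ x, p x * f x := fun f hf =>
    Finset.sum_pos' (fun x _ => mul_nonneg (hp0 x) (hf x).le)
      ⟨x₀, Finset.mem_univ _, mul_pos hx₀' (hf x₀)⟩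
  have hjensen : ∀ f : X → ℝ, (∀ x, 0 < f x) →
      ∑ x, p x * Real.log (f x) ≤ Real.log (∑ x, p x * f x) := fun f hf => by
    simpa using strictConcaveOn_log_Ioi.concaveOn.le_map_sum (t := Finset.univ)
      (fun x _ => hp0 x) hp1 (fun x _ => hf x)
  simp only [div_eq_mul_inv] at hM
  have hS0 := hsum_pos (fun x => (u x)⁻¹) fun x => inv_pos.2 (hpos x)
  have hlogM : Real.log (∑ x, p x * (u x)⁻¹) ≤ Real.log M := Real.log_le_log hS0 hM
  have hone : -∑ x, p x * Real.log (u x) ≤ Real.log M := by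
    refine le_trans ?_ hlogM
    simpa [Real.log_inv] using hjensen (fun x => (u x)⁻¹) fun x => inv_pos.2 (hpos x)
  unfold alphaComplexity
  rw [← hu]
  split_ifs with h1 h2
  · exact hone
  · refine le_trans (neg_le_neg ?_) hone
    rw [← one_mul (Real.log _), ← hp1, Finset.sum_mul]
    refine Finset.sum_le_sum fun x _ => ?_
    rcases (hp0 x).eq_or_lt with h | h
    · rw [← h]; simp
    · exact mul_le_mul_of_nonneg_left (Real.log_le_log (hpos x)
        (le_csSup (Set.toFinite _).bddAbove ⟨x, h.ne', rfl⟩)) h.le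
  · have hα : α.toReal ≠ 1 := by
      intro h
      apply h1
      rw [← ENNReal.ofReal_toReal h2, h, ENNReal.ofReal_one]
    have hT0 := hsum_pos (fun x => u x ^ (α.toReal - 1)) fun x => Real.rpow_pos_of_pos (hpos x) _
    rcases lt_or_gt_of_ne hα with h | h
    -- For `α < 1`: Jensen for the concave power `y ↦ y^(1 - α)` at `y = 1 / u`.
    · have hJ : ∑ x, p x * u x ^ (α.toReal - 1) ≤ (∑ x, p x * (u x)⁻¹) ^ (1 - α.toReal) := by
        have hc := (Real.concaveOn_rpow (p := 1 - α.toReal) (by linarith)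
          (by linarith [@ENNReal.toReal_nonneg α])).le_map_sum (t := Finset.univ) (w := p)
          (p := fun x => (u x)⁻¹) (fun x _ => hp0 x) hp1 (fun x _ => (inv_pos.2 (hpos x)).le)
        simp only [smul_eq_mul] at hc
        refine le_trans (le_of_eq (Finset.sum_congr rfl fun x _ => ?_)) hc
        rw [Real.inv_rpow (hpos x).le, ← Real.rpow_neg (hpos x).le, neg_sub]
      have hl := Real.log_le_log hT0 hJ
      rw [Real.log_rpow hS0] at hl
      rw [one_div, inv_mul_le_iff₀ (by linarith)]
      exact hl.trans (mul_le_mul_of_nonneg_left hlogM (by linarith))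
    -- For `α > 1`: Jensen for `log` gives `H_α ≤ H_1`.
    · have hl := hjensen (fun x => u x ^ (α.toReal - 1)) fun x => Real.rpow_pos_of_pos (hpos x) _
      have he : ∑ x, p x * Real.log (u x ^ (α.toReal - 1))
          = (α.toReal - 1) * ∑ x, p x * Real.log (u x) := by
        rw [Finset.mul_sum]
        refine Finset.sum_congr rfl fun x _ => ?_
        rw [Real.log_rpow (hpos x)]
        ring
      rw [he] at hl
      have h3 : 1 / (1 - α.toReal) = -(α.toReal - 1)⁻¹ := by
        rw [one_div, ← inv_neg, neg_sub]
      refine le_trans ?_ hone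
      rw [h3, neg_mul, neg_le_neg_iff, le_inv_mul_iff₀ (by linarith)]
      exact hl

/-- If `Zp` is constant, then `H_α(p)` does not depend on `α`. -/
theorem alphaComplexity_of_mulVec_eq {X : Type*} [Fintype X] (Z : Matrix X X ℝ) (α : ℝ≥0∞)
    {p : X → ℝ} (hp : p ∈ stdSimplex ℝ X) {M : ℝ} (hM : 0 < M)
    (h : ∀ x, (Z.mulVec p) x = M⁻¹) :
    alphaComplexity Z α p = Real.log M := by
  obtain ⟨hp0, hp1⟩ := hp
  obtain ⟨x₀, hx₀⟩ : ∃ x, p x ≠ 0 := by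
    by_contra! h
    simp [h] at hp1
  unfold alphaComplexity
  split_ifs with h1 h2
  · simp [h, ← Finset.sum_mul, hp1]
  · have : Z.mulVec p '' Function.support p = {M⁻¹} := by
      refine Set.eq_singleton_iff_unique_mem.2 ⟨⟨x₀, hx₀, h x₀⟩, ?_⟩
      rintro _ ⟨x, _, rfl⟩
      exact h x
    simp [this]
  · have hα : 1 - α.toReal ≠ 0 := by
      intro h0
      apply h1
      rw [← ENNReal.ofReal_toReal h2, ← sub_eq_zero.1 h0, ENNReal.ofReal_one]
    simp only [h]
    rw [← Finset.sum_mul, hp1, one_mul, Real.log_rpow (inv_pos.2 hM), Real.log_inv]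
    field_simp
    ring

theorem mulVec_laplaceKernel {t : ℝ} {F : Finset ℝ} (p : ℝ → ℝ) (x : F) :
    (laplaceKernel F t).mulVec (fun y => p y) x = potential t F p x := by
  rw [potential, ← Finset.sum_coe_sort]
  rfl

/-- The complexity of a finite subset of the line. -/
theorem GapSum.finComplexity_eq {t : ℝ} {F : Finset ℝ} {a b s : ℝ} (α : ℝ≥0∞) (ht : 0 ≤ t)
    (h : GapSum t F a b s) : finComplexity α t F = Real.log (1 + s) := by
  have hs : 0 < 1 + s := by linarith [h.sum_nonneg ht]
  refine IsGreatest.csSup_eq ⟨?_, ?_⟩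
  · obtain ⟨w, hw0, -, hw1, hws⟩ := h.exists_weighting ht
    have hp : (fun y : F => (1 + s)⁻¹ * w y) ∈ stdSimplex ℝ F := by
      refine ⟨fun y => mul_nonneg (inv_pos.2 hs).le (hw0 y y.2), ?_⟩
      rw [← Finset.mul_sum, Finset.sum_coe_sort F w, hws, inv_mul_cancel₀ hs.ne']
    refine ⟨_, hp, alphaComplexity_of_mulVec_eq _ α hp hs fun x => ?_⟩
    rw [mulVec_laplaceKernel (fun y => (1 + s)⁻¹ * w y)]
    have : potential t F (fun y => (1 + s)⁻¹ * w y) x = (1 + s)⁻¹ * potential t F w x := by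
      rw [potential, potential, Finset.mul_sum]
      exact Finset.sum_congr rfl fun y _ => by ring
    rw [this, hw1 x x.2, mul_one]
  · rintro _ ⟨p, hp, rfl⟩
    obtain ⟨p', rfl⟩ : ∃ p' : ℝ → ℝ, p = fun y : F => p' y :=
      ⟨fun x => if hx : x ∈ F then p ⟨x, hx⟩ else 0, by ext y; simp⟩
    obtain ⟨hp0, hp1⟩ := id hp
    have hp0' : ∀ x ∈ F, 0 ≤ p' x := fun x hx => hp0 ⟨x, hx⟩
    have hpos : ∀ x, 0 < potential t F p' x := by
      obtain ⟨x₀, hx₀⟩ : ∃ x : F, p' x ≠ 0 := by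
        by_contra! h
        simp [h] at hp1
      exact fun x => Finset.sum_pos'
        (fun y hy => mul_nonneg (Real.exp_pos _).le (hp0' y hy))
        ⟨x₀, x₀.2, mul_pos (Real.exp_pos _) ((hp0 x₀).lt_of_ne' hx₀)⟩
    refine alphaComplexity_le_log _ α hp (fun x => ?_) ?_
    · rw [mulVec_laplaceKernel]; exact hpos x
    · simp only [mulVec_laplaceKernel]
      rw [Finset.sum_coe_sort F fun x => p' x / potential t F p' x]
      exact h.sum_div_potential_le ht hp0' fun x _ => hpos x

/-! ### Compact sets and the two inequalities -/

theorem isLUB_kappa (α : ℝ≥0∞) {t : ℝ} (ht : 0 < t) {K : Set ℝ} (hne : K.Nonempty)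
    (hK : IsCompact K) :
    IsLUB {s | ∃ F : Finset ℝ, ∃ a b, (F : Set ℝ) ⊆ K ∧ GapSum t F a b s} (kappa α t K) := by
  constructor
  · rintro s ⟨F, a, b, hF, h⟩
    have hle := le_csSup (bddAbove_finComplexity α ht hK) ⟨F, hF, rfl⟩
    rw [h.finComplexity_eq α ht.le,
      Real.log_le_iff_le_exp (by linarith [h.sum_nonneg ht.le])] at hle
    exact le_sub_iff_add_le'.2 hle
  · intro c hc
    obtain ⟨x, hx⟩ := hne
    have hc0 : 0 ≤ c := hc ⟨{x}, x, x, by simpa using hx, .single x⟩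
    rw [kappa, sub_le_iff_le_add', ← Real.le_log_iff_exp_le (by linarith)]
    refine csSup_le ⟨_, ∅, by simp, rfl⟩ ?_
    rintro _ ⟨F, hF, rfl⟩
    rcases F.eq_empty_or_nonempty with rfl | hFne
    · have : finComplexity α t (∅ : Finset ℝ) = 0 := by
        have he : stdSimplex ℝ (∅ : Finset ℝ) = ∅ :=
          Set.eq_empty_of_forall_notMem fun p hp => by simpa using hp.2
        rw [finComplexity, kernelComplexity, he, Set.image_empty, Real.sSup_empty]
      rw [this]
      exact Real.log_nonneg (by linarith)
    · obtain ⟨a, b, s, h⟩ := GapSum.exists_of_nonempty t F hFne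
      rw [h.finComplexity_eq α ht.le]
      exact Real.log_le_log (by linarith [h.sum_nonneg ht.le])
        (by linarith [hc ⟨F, a, b, hF, h⟩])

theorem kappa_add_le (α : ℝ≥0∞) {t : ℝ} (ht : 0 < t) {A B : Set ℝ} (hA : A.Nonempty)
    (hA' : IsCompact A) (hB : B.Nonempty) (hB' : IsCompact B) :
    kappa α t A + kappa α t B ≤ kappa α t (A + B) := by
  rw [← le_sub_iff_add_le]
  refine (isLUB_kappa α ht hA hA').2 ?_
  rintro s ⟨F, a, b, hF, h⟩
  rw [le_sub_comm]
  refine (isLUB_kappa α ht hB hB').2 ?_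
  rintro r ⟨G, c, d, hG, h'⟩
  rw [le_sub_iff_add_le']
  -- Shifting `G` by `max F` puts its minimum on the maximum of `F + min G`.
  have hg := h'.translate b
  rw [add_comm c b] at hg
  refine (isLUB_kappa α ht (hA.add hB) (hA'.add hB')).1
    ⟨_, _, _, ?_, (h.translate c).union hg⟩
  intro x hx
  rcases Finset.mem_union.1 (Finset.mem_coe.1 hx) with hx | hx
  · obtain ⟨y, hy, rfl⟩ := Finset.mem_image.1 hx
    exact Set.add_mem_add (hF hy) (hG h'.min_mem)
  · obtain ⟨y, hy, rfl⟩ := Finset.mem_image.1 hx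
    rw [add_comm y b]
    exact Set.add_mem_add (hF h.max_mem) (hG hy)

theorem mul_kappa_le_kappa_smul (α : ℝ≥0∞) {t l : ℝ} (ht : 0 < t) (h0 : 0 ≤ l) (h1 : l ≤ 1)
    {A : Set ℝ} (hA : A.Nonempty) (hA' : IsCompact A) :
    l * kappa α t A ≤ kappa α t (l • A) := by
  have hsm := isLUB_kappa α ht (hA.smul_set (a := l)) (hA'.smul l)
  have key : ∀ s ∈ {s | ∃ F : Finset ℝ, ∃ a b, (F : Set ℝ) ⊆ A ∧ GapSum t F a b s},
      l * s ≤ kappa α t (l • A) := by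
    rintro s ⟨F, a, b, hF, h⟩
    obtain ⟨s', hs, h'⟩ := h.exists_scale ht.le h0 h1
    refine hs.trans (hsm.1 ⟨_, _, _, ?_, h'⟩)
    intro x hx
    obtain ⟨y, hy, rfl⟩ := Finset.mem_image.1 (Finset.mem_coe.1 hx)
    exact ⟨y, hF hy, rfl⟩
  -- Division by `l` needs `l > 0`; for `l = 0` a one-point set gives non-negativity.
  rcases h0.eq_or_lt with rfl | hl
  · obtain ⟨x, hx⟩ := hA
    simpa using key 0 ⟨{x}, x, x, by simpa using hx, .single x⟩
  · rw [← le_div_iff₀' hl]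
    exact (isLUB_kappa α ht hA hA').2 fun s hs => (le_div_iff₀' hl).2 (key s hs)

end MetricComplexity

theorem theorem1p7 (α : ℝ≥0∞) (t : ℝ) (ht : 0 < t) (A B : Set ℝ)
    (hA : A.Nonempty) (hA' : IsCompact A) (hB : B.Nonempty) (hB' : IsCompact B) :
    MetricComplexity.kappa α t A + MetricComplexity.kappa α t B
        ≤ MetricComplexity.kappa α t (A + B) ∧
    ∀ l ∈ Set.Icc (0 : ℝ) 1,
      (1 - l) * MetricComplexity.kappa α t A + l * MetricComplexity.kappa α t B
        ≤ MetricComplexity.kappa α t ((1 - l) • A + l • B) := by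
  refine ⟨MetricComplexity.kappa_add_le α ht hA hA' hB hB', fun l hl => ?_⟩
  exact (add_le_add
    (MetricComplexity.mul_kappa_le_kappa_smul α ht (sub_nonneg.2 hl.2) (by linarith [hl.1]) hA hA')
    (MetricComplexity.mul_kappa_le_kappa_smul α ht hl.1 hl.2 hB hB')).trans
    (MetricComplexity.kappa_add_le α ht hA.smul_set (hA'.smul _) hB.smul_set (hB'.smul _))
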